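/- Let $\mathcal A=\{H_1,\dots,H_n\}$ be an arrangement of $n$ affine lines in $\mathbb C^2$, no two of them parallel, with complement $M=\mathbb C^2\setminus\bigcup_i H_i$ and group $G=\pi_1(M)$. Let $\Lambda=\mathbb Z[t_1^{\pm1},\dots,t_n^{\pm1}]$, the group ring of $H_1(M)\cong\mathbb Z^n$, where $t_i$ is the class of the positively oriented meridian of $H_i$ (the identification is given by the winding numbers around the lines). For a group $\Gamma$ with $\Gamma/\Gamma'\cong\mathbb Z^n$ let $B(\Gamma)=\Gamma'/\Gamma''$ be its Alexander invariant, a $\Lambda$-module through conjugation. For a finitely presented $\Lambda$-module $N$ with presentation $\Lambda^p\to\Lambda^q\to N\to 0$, let $F_k(N)$ be its $k$-th Fitting ideal, generated by the $(q-k+1)\times(q-k+1)$ minors of the presentation matrix, and let $V_k(N)\subseteq(\mathbb C^*)^n$ be the zero set of $F_k(N)$. Put $V_k(\Gamma)=V_k(B(\Gamma))$, $B(\mathcal A)=B(G)$ and $V_k(\mathcal A)=V_k(G)$. Let $L_2$ be the set of rank-two flats of $\mathcal A$: the sets $X\subseteq\{1,\dots,n\}$ with $|X|\ge2$ that consist of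 the indices of all lines through some point of $\mathbb C^2$. For $X\in L_2$ let $$G_X=\langle \gamma_1,\dots,\gamma_n\mid [\gamma_X,\gamma_i]=1\ (i\in X),\ [\gamma_j,\gamma_i]=1\ (j\notin X,\ 1\le i\le n)\rangle,\qquad \gamma_X=\prod_{i\in X}\gamma_i$$ (the product being taken in increasing order), with $\gamma_i\mapsto t_i$, let $B_X=B(G_X)$, and let $$V_X=\{t\in(\mathbb C^*)^n\mid \textstyle\prod_{i\in X}t_i=1,\ t_j=1\text{ for }j\notin X\}.$$ Let $B^{cc}(\mathcal A)=\bigoplus_{X\in L_2}B_X$ be the coarse Alexander invariant and $V^{cc}_k(\mathcal A)=V_k(B^{cc}(\mathcal A))$ the coarse characteristic varieties. The arrangement is called decomposable if $B(\mathcal A)\cong B^{cc}(\mathcal A)$ as $\Lambda$-modules. **Theorem.** For every $k\ge1$ the coarse characteristic variety $V^{cc}_k(\mathcal A)$ is determined by the lattice of $\mathcal A$, as follows. Write $\mathbf 1=(1,\dots,1)$. 1. Away from $\mathbf 1$, $$V^{cc}_k(\mathcal A)\setminus\{\mathbf 1\}=\bigcup_{X\in L_2}V_k(G_X)\setminus\{\mathbf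 1\}=\bigcup_{X\in L_2,\ |X|\ge k+2}V_X\setminus\{\mathbf 1\}.$$ 2. The point $\mathbf 1$ lies in $V^{cc}_k(\mathcal A)$ if and only if $k\le\sum_{X\in L_2}\binom{|X|-1}{2}$; it lies in $\bigcup_{X\in L_2}V_k(G_X)$ if and only if $k\le\binom{|X|-1}{2}$ for some $X\in L_2$; and it lies in $\bigcup_{X\in L_2,\ |X|\ge k+2}V_X$ if and only if some $X\in L_2$ has $|X|\ge k+2$. 3. In particular, if some $X\in L_2$ has $|X|\ge k+2$, then $$V^{cc}_k(\mathcal A)=\bigcup_{X\in L_2}V_k(G_X)=\bigcup_{X\in L_2,\ |X|\ge k+2}V_X.$$ 4. If $\mathcal A$ is decomposable, then $V_k(\mathcal A)=V^{cc}_k(\mathcal A)$. Hence $V_k(\mathcal A)\setminus\{\mathbf 1\}=\bigcup_{X\in L_2,\ |X|\ge k+2}V_X\setminus\{\mathbf 1\}$, and $V_k(\mathcal A)=\bigcup_{X\in L_2,\ |X|\ge k+2}V_X$ if some $X\in L_2$ has $|X|\ge k+2$. -/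

import Mathlib

open scoped DirectSum TensorProduct commutatorElement

noncomputable section

namespace CharVar

/-! ### Fitting ideals -/

section Fitting

variable {R : Type*} [CommRing R]

/-- The ideal generated by the `s × s` minors of the matrix `Ω`. (Choices of rows or columns with
repetitions or in another order contribute only `0` or `±` a minor.) -/
def minorsIdeal {p q : ℕ} (Ω : Matrix (Fin p) (Fin q) R) (s : ℕ) : Ideal R :=
  Ideal.span {d | ∃ (r : Fin s → Fin p) (c : Fin s → Fin q), d = (Ω.submatrix r c).det}

/-- `R^p → R^q → M → 0` is exact, the first map being `v ↦ v Ω`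
(so the relations are the rows of `Ω`). -/
def IsPresentation {p q : ℕ} (Ω : Matrix (Fin p) (Fin q) R)
    (M : Type*) [AddCommGroup M] [Module R M] : Prop :=
  ∃ π : (Fin q → R) →ₗ[R] M,
    Function.Surjective π ∧ LinearMap.ker π = Submodule.span R (Set.range Ω.row)

/-- The `k`-th Fitting ideal, generated by the `(q - k + 1) × (q - k + 1)` minors of a presentation
matrix `Ω` with `q` generators. As this ideal does not depend on the presentation, the supremum
over all finite presentations is that common value. For `k = 0` the minors have size
`q + 1` and vanish; for `k > q` they have size `0` and the ideal is `R`. -/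
def fittingIdeal (R : Type*) [CommRing R] (M : Type*) [AddCommGroup M] [Module R M]
    (k : ℕ) : Ideal R :=
  ⨆ (p : ℕ) (q : ℕ) (Ω : Matrix (Fin p) (Fin q) R) (_ : IsPresentation Ω M),
    minorsIdeal Ω (q + 1 - k)

end Fitting

/-! ### Laurent polynomials and characteristic varieties of modules -/

/-- The group `ℤⁿ`, written multiplicatively. -/
abbrev Zn (n : ℕ) : Type := Multiplicative (Fin n → ℤ)

/-- The Laurent polynomial ring `Λ = ℤ[t₁^±1, …, t_n^±1]`, as the group ring of `ℤⁿ`. -/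
abbrev Laurent (n : ℕ) : Type := MonoidAlgebra ℤ (Zn n)

/-- The complex torus `(ℂ^*)ⁿ`. -/
abbrev Torus (n : ℕ) : Type := Fin n → ℂˣ

/-- The character `v ↦ t₁^{v₁} ⋯ t_n^{v_n}` of `ℤⁿ` given by a point of the torus. -/
def character {n : ℕ} (t : Torus n) : Zn n →* ℂ where
  toFun v := ((∏ i, t i ^ (v.toAdd i) : ℂˣ) : ℂ)
  map_one' := by simp
  map_mul' v w := by simp [zpow_add, Finset.prod_mul_distrib]

/-- Evaluation `f ↦ f(t)` of Laurent polynomials at a point of the torus. -/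
def evalAt {n : ℕ} (t : Torus n) : Laurent n →ₐ[ℤ] ℂ :=
  MonoidAlgebra.lift ℤ ℂ (Zn n) (character t)

/-- The `k`-th characteristic variety of a `Λ`-module: the common zeros in `(ℂ^*)ⁿ` of its `k`-th
Fitting ideal (equivalently, of the extension of this ideal to complex Laurent polynomials). -/
def charVariety {n : ℕ} (M : Type*) [AddCommGroup M] [Module (Laurent n) M] (k : ℕ) :
    Set (Torus n) :=
  {t | ∀ f ∈ fittingIdeal (Laurent n) M k, evalAt t f = 0}

/-! ### Alexander invariants of groups -/

section Alexander

variable (G : Type) [Group G]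

/-- `G'/G''`, where `G'` is the commutator subgroup, written additively. -/
abbrev DerivedQuotient : Type := Additive (Abelianization (commutator G))

/-- The action of `G` on `G'/G''` by conjugation. -/
def conjRep : Representation ℤ G (DerivedQuotient G) where
  toFun g := (MonoidHom.toAdditive (Abelianization.map
    (MulAut.conjNormal (H := commutator G) g).toMonoidHom)).toIntLinearMap
  map_one' := by
    ext x
    induction x using Additive.rec with | _ x =>
    induction x using QuotientGroup.induction_on with | _ x =>
    change Additive.ofMul (Abelianization.of _) = Additive.ofMul (Abelianization.of _)
    congr 2
    simp
  map_mul' g h := by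
    ext x
    induction x using Additive.rec with | _ x =>
    induction x using QuotientGroup.induction_on with | _ x =>
    change Additive.ofMul (Abelianization.of _) = Additive.ofMul (Abelianization.of _)
    congr 2
    simp

theorem commutator_le_ker_conjRep : commutator G ≤ (conjRep G).ker := by
  intro g hg
  rw [MonoidHom.mem_ker]
  ext x
  induction x using Additive.rec with | _ x =>
  induction x using QuotientGroup.induction_on with | _ x =>
  change Additive.ofMul (Abelianization.of _) = Additive.ofMul (Abelianization.of _)
  have h : MulAut.conjNormal (H := commutator G) g x
      = (⟨g, hg⟩ : commutator G) * x * (⟨g, hg⟩ : commutator G)⁻¹ := by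
    ext; simp
  congr 1
  change Abelianization.of (MulAut.conjNormal (H := commutator G) g x) = _
  rw [h, map_mul, map_mul, map_inv, mul_comm, inv_mul_cancel_left]

/-- The action of `G/G'` on `G'/G''` induced by conjugation. -/
def alexanderRep : Representation ℤ (Abelianization G) (DerivedQuotient G) :=
  QuotientGroup.lift (commutator G) (conjRep G) (commutator_le_ker_conjRep G)

variable {G}

/-- The homomorphism of group rings `ℤ[G/G'] → ℤ[ℤⁿ]` induced by `φ : G → ℤⁿ`. -/
def groupRingMap {n : ℕ} (φ : G →* Zn n) :
    MonoidAlgebra ℤ (Abelianization G) →+* Laurent n :=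
  MonoidAlgebra.mapDomainRingHom ℤ (Abelianization.lift φ)

/-- The Alexander invariant `G'/G''` over the Laurent polynomial ring `Λ`. Here `φ : G → ℤⁿ` is the
map that identifies `G/G'` with `ℤⁿ`, and the `ℤ[G/G']`-module `G'/G''` is transported to `Λ` by
extension of scalars along the (then bijective) ring homomorphism `ℤ[G/G'] → Λ`. -/
def AlexanderInvariant {n : ℕ} (φ : G →* Zn n) : Type :=
  letI := (groupRingMap φ).toAlgebra
  Laurent n ⊗[MonoidAlgebra ℤ (Abelianization G)] (alexanderRep G).asModule

instance {n : ℕ} (φ : G →* Zn n) : AddCommGroup (AlexanderInvariant φ) :=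
  letI := (groupRingMap φ).toAlgebra
  (TensorProduct.addCommGroup : AddCommGroup
    (Laurent n ⊗[MonoidAlgebra ℤ (Abelianization G)] (alexanderRep G).asModule))

instance {n : ℕ} (φ : G →* Zn n) : Module (Laurent n) (AlexanderInvariant φ) :=
  letI := (groupRingMap φ).toAlgebra
  (TensorProduct.leftModule : Module (Laurent n)
    (Laurent n ⊗[MonoidAlgebra ℤ (Abelianization G)] (alexanderRep G).asModule))

end Alexander

/-! ### Winding numbers -/

section Winding

/-- The isomorphism `ℤ ≃ 2πiℤ`, `m ↦ 2πi m`. -/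
def intEquivPeriods : ℤ ≃+ AddSubgroup.zmultiples (2 * Real.pi * Complex.I : ℂ) :=
  AddEquiv.ofBijective
    ((zmultiplesHom (AddSubgroup.zmultiples (2 * Real.pi * Complex.I : ℂ)))
      ⟨2 * Real.pi * Complex.I, AddSubgroup.mem_zmultiples _⟩) <| by
    constructor
    · intro a b h
      have h' := congrArg Subtype.val h
      simpa [Complex.I_ne_zero, Real.pi_ne_zero] using h'
    · rintro ⟨x, m, rfl⟩
      exact ⟨m, by ext; simp⟩

/-- The winding number around `0`, as a homomorphism `π₁(ℂ ∖ 0, z) → ℤ`: a loop is lifted along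
`exp` to a path that starts at `log z`, and its winding number is `m` if the lift ends at
`log z + 2πi m`. -/
def windingHom (z : {z : ℂ // z ≠ 0}) : FundamentalGroup {z : ℂ // z ≠ 0} z →* Multiplicative ℤ :=
  (((AddEquiv.toMultiplicative intEquivPeriods).symm.toMonoidHom).comp
    (MulOpposite.opMulEquiv (M := Multiplicative
      (AddSubgroup.zmultiples (2 * Real.pi * Complex.I : ℂ)))).symm.toMonoidHom).comp
    (Complex.isAddQuotientCoveringMap_exp.fundamentalGroupToMulOpposite
      ⟨Complex.log z, Subtype.ext (Complex.exp_log z.2)⟩)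

end Winding

/-! ### Line arrangements -/

/-- An arrangement of `n` affine lines `H_i = {(x, y) | a_i x + b_i y = c_i}` in `ℂ²` that is
transverse to infinity: no two of the lines are parallel (in particular they are distinct). -/
structure LineArrangement (n : ℕ) where
  /-- coefficients of `x` -/
  a : Fin n → ℂ
  /-- coefficients of `y` -/
  b : Fin n → ℂ
  /-- constant terms -/
  c : Fin n → ℂ
  isLine : ∀ i, a i ≠ 0 ∨ b i ≠ 0
  transverse : ∀ i j, i ≠ j → a i * b j - a j * b i ≠ 0

namespace LineArrangement

variable {n : ℕ} (A : LineArrangement n)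

/-- The affine function `a_i x + b_i y - c_i` that defines the line `H_i`. -/
def form (i : Fin n) (p : ℂ × ℂ) : ℂ := A.a i * p.1 + A.b i * p.2 - A.c i

/-- The line `H_i`. -/
def line (i : Fin n) : Set (ℂ × ℂ) := {p | A.form i p = 0}

/-- The complement `M = ℂ² ∖ ⋃ H_i`. -/
abbrev Complement : Type := {p : ℂ × ℂ // p ∉ ⋃ i, A.line i}

/-- The function `M → ℂ ∖ 0` given by the affine function that defines `H_i`. -/
def formMap (i : Fin n) : C(A.Complement, {z : ℂ // z ≠ 0}) where
  toFun p := ⟨A.form i p.1, fun h => p.2 (Set.mem_iUnion.2 ⟨i, h⟩)⟩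
  continuous_toFun := by
    unfold form
    fun_prop

/-- The homomorphism `π₁(M, x) → ℤⁿ` that sends a loop to its winding numbers around the lines
`H_1, …, H_n`. It identifies `H₁(M)` with `ℤⁿ`, the (positively oriented) meridian of `H_i` being
sent to the `i`-th basis vector. -/
def windingNumbers (x : A.Complement) : FundamentalGroup A.Complement x →* Zn n where
  toFun g := Multiplicative.ofAdd fun i =>
    (windingHom (A.formMap i x) (FundamentalGroup.map (A.formMap i) x g)).toAdd
  map_one' := by
    simp only [map_one]
    rfl
  map_mul' g h := by
    simp only [map_mul]
    rfl

/-- The Alexander invariant `B(𝒜) = G'/G''`, `G = π₁(M, x)`, as a module over `Λ`. -/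
abbrev Alexander (x : A.Complement) : Type := AlexanderInvariant (A.windingNumbers x)

/-- The characteristic variety `V_k(𝒜)`. -/
def charVar (x : A.Complement) (k : ℕ) : Set (Torus n) := charVariety (A.Alexander x) k

open Classical in
/-- The vertex set of a point `v`: the indices of the lines through `v`. -/
def vertexSet (v : ℂ × ℂ) : Finset (Fin n) := Finset.univ.filter fun i => v ∈ A.line i

open Classical in
/-- The rank two flats of the intersection lattice, each identified with the set of (indices of)
the lines that contain it. -/
def L2 : Finset (Finset (Fin n)) :=
  Finset.univ.filter fun X => 2 ≤ X.card ∧ ∃ v, A.vertexSet v = X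

end LineArrangement

/-! ### Local invariants -/

section Local

variable {n : ℕ} (X : Finset (Fin n))

/-- `γ_X`, the product of the generators `γ_i`, `i ∈ X`, in increasing order. -/
def gammaX : FreeGroup (Fin n) := ((X.sort (· ≤ ·)).map FreeGroup.of).prod

/-- The relators `[γ_X, γ_i]` for `i ∈ X` and `[γ_j, γ_i]` for `j ∉ X` and all `i`. -/
def localRels : Set (FreeGroup (Fin n)) :=
  {r | ∃ i ∈ X, r = ⁅gammaX X, FreeGroup.of i⁆} ∪
    {r | ∃ j i, j ∉ X ∧ r = ⁅FreeGroup.of j, FreeGroup.of i⁆}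

/-- The local group
`G_X = ⟨γ₁, …, γ_n | [γ_X, γ_i] (i ∈ X), [γ_j, γ_i] (j ∉ X, i arbitrary)⟩`. -/
abbrev LocalGroup : Type := PresentedGroup (localRels X)

/-- The homomorphism `G_X → ℤⁿ`, `γ_i ↦ t_i`, that identifies the abelianization with `ℤⁿ`. -/
def localAb : LocalGroup X →* Zn n :=
  PresentedGroup.toGroup (f := fun i => Multiplicative.ofAdd (Pi.single i (1 : ℤ))) <| by
    rintro r (⟨i, -, rfl⟩ | ⟨j, i, -, rfl⟩) <;>
    rw [map_commutatorElement, commutatorElement_eq_one_iff_mul_comm, mul_comm]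

/-- The local Alexander invariant `B_X = B(G_X)`. -/
abbrev LocalAlexander : Type := AlexanderInvariant (localAb X)

/-- The characteristic variety `V_k(G_X)`. -/
def localCharVar (k : ℕ) : Set (Torus n) := charVariety (LocalAlexander X) k

/-- The local torus `V_X`, given by `∏_{i ∈ X} t_i = 1` and `t_j = 1` for `j ∉ X`. -/
def localTorus : Set (Torus n) := {t | ∏ i ∈ X, t i = 1 ∧ ∀ j, j ∉ X → t j = 1}

end Local

namespace LineArrangement

variable {n : ℕ} (A : LineArrangement n)

/-- The coarse Alexander invariant `B^cc(𝒜)`, the direct sum of the `B_X` over all rank two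
flats `X`. -/
abbrev CoarseAlexander : Type := ⨁ X : A.L2, LocalAlexander (X : Finset (Fin n))

/-- The coarse characteristic variety `V^cc_k(𝒜)`. -/
def coarseCharVar (k : ℕ) : Set (Torus n) := charVariety A.CoarseAlexander k

/-- The arrangement is decomposable: `B(𝒜) ≅ B^cc(𝒜)` as `Λ`-modules. -/
def IsDecomposable (x : A.Complement) : Prop :=
  Nonempty (A.Alexander x ≃ₗ[Laurent n] A.CoarseAlexander)

end LineArrangement

end CharVar

end

/-!
The points of a characteristic variety are detected by fibres. At a point `t` of the torus let `ℂ_t`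
be the field `ℂ` as an algebra over the Laurent polynomials through evaluation at `t`. The maps
`M → ℂ_t` form the kernel of the presentation matrix evaluated at `t`, so the `k`-th Fitting ideal
of a finitely generated module `M` vanishes at `t` exactly when `k ≤ dim Hom(M, ℂ_t)`
(`fittingIdeal_le_ker_iff`). This dimension is additive in `M`, which reduces the coarse
characteristic variety to the local groups `G_X`.

For the Alexander invariant of a group `G`, the space `Hom(B(G), ℂ_t)` consists of the additive
functions `F` on `G'` with `F (g x g⁻¹) = χ(g) F(x)`, where `χ` is the character of `G` given by `t`
(`finrank_alexander_hom`). For fixed `h` the function `g ↦ F ([g, h])` is a crossed homomorphism.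

* If `t ∉ V_X`, one of the central elements `γ_X`, `γ_j` (`j ∉ X`) of `G_X` acts on `ℂ_t` by a
  scalar other than `1`, and `F = 0` (`equivariantHoms_local_eq_bot`).
* If `t ∈ V_X` and `t_{i₀} ≠ 1`, then `F` is given by its values on the `[γ_i, γ_{i₀}]` for
  `i ∈ X ∖ i₀`, and `γ_X` imposes one linear relation on these. Conversely a crossed homomorphism
  with prescribed values on the generators is the translation part of an action on `ℂ` by affine
  maps. The dimension is `|X| - 2` (`finrank_equivariantHoms_local`).
* If `t = 1`, then `([g], [h]) ↦ F ([g, h])` is an alternating form on a space of dimension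
  `|X| - 1`, and every such form comes from a homomorphism to a Heisenberg group. The dimension is
  the binomial coefficient of `|X| - 1` over `2` (`finrank_equivariantHoms_local_one`).

Two lines meet in at most one point, so distinct flats share at most one line and their local tori
meet only in `1` (`LineArrangement.eq_of_mem_localTorus`). Away from `1` at most one summand of the
coarse Alexander invariant therefore contributes, while at `1` the dimensions add up. In the
decomposable case the two Fitting ideals agree, being those of isomorphic modules.
-/

noncomputable section

namespace CharVar

/-! ### Fitting ideals and fibres of a module -/

section Fibre

/-- A matrix over a field has rank less than `s` exactly when all its `s × s` minors vanish. -/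
theorem rank_lt_iff_forall_minor_eq_zero {K : Type*} [Field K] {p q : ℕ}
    (W : Matrix (Fin p) (Fin q) K) (s : ℕ) :
    W.rank < s ↔ ∀ (r : Fin s → Fin p) (c : Fin s → Fin q), (W.submatrix r c).det = 0 := by
  constructor
  · intro h r c
    by_contra hd
    have h1 : (W.submatrix r c).rank = s := by
      simpa using Matrix.rank_of_det_ne_zero hd
    have h2 := W.rank_submatrix_le r c
    omega
  · intro h
    by_contra! hs
    -- A family of `s` independent rows can be chosen, and then `s` independent columns of these.
    have key : ∀ {m n : ℕ} (V : Matrix (Fin m) (Fin n) K), s ≤ V.rank →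
        ∃ r : Fin s → Fin m, LinearIndependent K (V.submatrix r id).row := by
      intro m n V hV
      obtain ⟨κ, a, -, hspan, hli⟩ := exists_linearIndependent' K V.row
      have hfin : Finite κ := hli.finite
      have := Fintype.ofFinite κ
      have hcard : Fintype.card κ = V.rank := by
        rw [Matrix.rank_eq_finrank_span_row, ← hspan, finrank_span_eq_card hli]
      let e : Fin s ↪ κ :=
        (Fin.castLEEmb (hV.trans hcard.ge)).trans (Fintype.equivFin κ).symm.toEmbedding
      exact ⟨a ∘ e, hli.comp e e.injective⟩
    obtain ⟨r, hr⟩ := key W hs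
    have hr' : s ≤ (W.submatrix r id).transpose.rank := by
      rw [Matrix.rank_transpose, hr.rank_matrix, Fintype.card_fin]
    obtain ⟨c, hc⟩ := key _ hr'
    have hu := Matrix.linearIndependent_rows_iff_isUnit.1 hc
    rw [Matrix.isUnit_iff_isUnit_det] at hu
    refine hu.ne_zero ?_
    rw [← Matrix.det_transpose]
    exact h r c

variable {R K M : Type*} [CommRing R] [Field K] [Algebra R K] [AddCommGroup M] [Module R M]

/-- The linear maps `M → K` correspond to the solutions `v` of `Ω v = 0` over `K`. -/
theorem IsPresentation.finrank_hom_add_rank {p q : ℕ} {Ω : Matrix (Fin p) (Fin q) R}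
    (h : IsPresentation Ω M) :
    Module.finrank K (M →ₗ[R] K) + (Ω.map (algebraMap R K)).rank = q := by
  obtain ⟨π, hπ, hker⟩ := h
  let E : (M →ₗ[R] K) →ₗ[K] (Fin q → K) :=
    { toFun f i := f (π (Pi.single i 1))
      map_add' _ _ := rfl
      map_smul' _ _ := rfl }
  have hE (f : M →ₗ[R] K) (x : Fin q → R) : f (π x) = ∑ i, algebraMap R K (x i) * E f i := by
    conv_lhs => rw [pi_eq_sum_univ' x]
    simp only [map_sum, map_smul]
    exact Finset.sum_congr rfl fun i _ => Algebra.smul_def _ _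
  have hinj : Function.Injective E := by
    intro f g hfg
    ext m
    obtain ⟨x, rfl⟩ := hπ m
    rw [hE, hE, hfg]
  have hrange : LinearMap.range E = LinearMap.ker (Ω.map (algebraMap R K)).mulVecLin := by
    ext v
    constructor
    · rintro ⟨f, rfl⟩
      ext j
      have hj : π (Ω.row j) = 0 := by
        rw [← LinearMap.mem_ker, hker]
        exact Submodule.subset_span ⟨j, rfl⟩
      have := hE f (Ω.row j)
      rw [hj, map_zero] at this
      simpa [Matrix.mulVec, dotProduct] using this.symm
    · intro hv
      let F : (Fin q → R) →ₗ[R] K := Fintype.linearCombination R v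
      have hF : LinearMap.ker π ≤ LinearMap.ker F := by
        rw [hker, Submodule.span_le]
        rintro _ ⟨j, rfl⟩
        have := congrFun (LinearMap.mem_ker.1 hv) j
        simpa [F, Fintype.linearCombination_apply, Matrix.mulVec, dotProduct,
          Algebra.smul_def] using this
      refine ⟨(Submodule.liftQ _ F hF) ∘ₗ
        (π.quotKerEquivOfSurjective hπ).symm.toLinearMap, ?_⟩
      ext i
      have : (π.quotKerEquivOfSurjective hπ).symm (π (Pi.single i 1)) =
          Submodule.Quotient.mk (Pi.single i 1) := by
        rw [LinearEquiv.symm_apply_eq]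
        rfl
      simp [E, this, F]
  have h1 := (Ω.map (algebraMap R K)).mulVecLin.finrank_range_add_finrank_ker
  rw [← hrange, LinearMap.finrank_range_of_inj hinj] at h1
  rw [Module.finrank_fin_fun] at h1
  rw [Matrix.rank]
  omega

/-- The `k`-th Fitting ideal of a finitely generated module over a Noetherian ring
vanishes at a `K`-point exactly when the (dual of the) fibre has dimension at least `k`. -/
theorem fittingIdeal_le_ker_iff [IsNoetherianRing R] [Module.Finite R M] (k : ℕ) :
    fittingIdeal R M k ≤ RingHom.ker (algebraMap R K) ↔ k ≤ Module.finrank K (M →ₗ[R] K) := by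
  have key {p q : ℕ} {Ω : Matrix (Fin p) (Fin q) R} (h : IsPresentation Ω M) :
      minorsIdeal Ω (q + 1 - k) ≤ RingHom.ker (algebraMap R K) ↔
        k ≤ Module.finrank K (M →ₗ[R] K) := by
    have h1 := h.finrank_hom_add_rank (K := K)
    have h2 : minorsIdeal Ω (q + 1 - k) ≤ RingHom.ker (algebraMap R K) ↔
        (Ω.map (algebraMap R K)).rank < q + 1 - k := by
      rw [rank_lt_iff_forall_minor_eq_zero, minorsIdeal, Ideal.span_le]
      constructor
      · intro h r c
        have := h ⟨r, c, rfl⟩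
        rw [SetLike.mem_coe, RingHom.mem_ker, RingHom.map_det] at this
        exact this
      · rintro h _ ⟨r, c, rfl⟩
        rw [SetLike.mem_coe, RingHom.mem_ker, RingHom.map_det]
        exact h r c
    rw [h2]
    omega
  simp only [fittingIdeal, iSup_le_iff]
  constructor
  · intro h
    obtain ⟨q, π, hπ⟩ := Module.Finite.exists_fin' R M
    obtain ⟨p, Ω, hΩ⟩ := Submodule.fg_iff_exists_fin_generating_family.1
      (IsNoetherian.noetherian (LinearMap.ker π))
    have hpres : IsPresentation (Matrix.of Ω) M := ⟨π, hπ, hΩ.symm⟩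
    exact (key hpres).1 (h _ _ _ hpres)
  · intro h p q Ω hpres
    exact (key hpres).2 h

theorem finrank_directSum_hom {ι : Type*} [Fintype ι] [DecidableEq ι] {N : ι → Type*}
    [∀ i, AddCommGroup (N i)] [∀ i, Module R (N i)]
    [IsNoetherianRing R] [∀ i, Module.Finite R (N i)] :
    Module.finrank K ((⨁ i, N i) →ₗ[R] K) = ∑ i, Module.finrank K (N i →ₗ[R] K) := by
  have hfin (i : ι) : Module.Finite K (N i →ₗ[R] K) := by
    obtain ⟨q, π, hπ⟩ := Module.Finite.exists_fin' R (N i)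
    exact Module.Finite.of_injective
      ({ toFun f j := f (π (Pi.single j 1))
         map_add' _ _ := rfl
         map_smul' _ _ := rfl } : (N i →ₗ[R] K) →ₗ[K] (Fin q → K)) <| by
      intro f g hfg
      have h1 : f ∘ₗ π = g ∘ₗ π := LinearMap.pi_ext' fun j => LinearMap.ext_ring (congrFun hfg j)
      ext m
      obtain ⟨x, rfl⟩ := hπ m
      exact LinearMap.congr_fun h1 x
  rw [← Module.finrank_pi_fintype]
  exact (DFinsupp.lsum (M := N) (N := K) (R := R) K).finrank_eq.symm

theorem fittingIdeal_congr {N : Type*} [AddCommGroup N] [Module R N] (e : M ≃ₗ[R] N) (k : ℕ) :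
    fittingIdeal R M k = fittingIdeal R N k := by
  have h {p q : ℕ} (Ω : Matrix (Fin p) (Fin q) R) :
      IsPresentation Ω M ↔ IsPresentation Ω N := by
    constructor
    · rintro ⟨π, hπ, hker⟩
      refine ⟨e.toLinearMap ∘ₗ π, e.surjective.comp hπ, ?_⟩
      rw [LinearMap.ker_comp_of_ker_eq_bot _ e.ker, hker]
    · rintro ⟨π, hπ, hker⟩
      refine ⟨e.symm.toLinearMap ∘ₗ π, e.symm.surjective.comp hπ, ?_⟩
      rw [LinearMap.ker_comp_of_ker_eq_bot _ e.symm.ker, hker]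
  simp only [fittingIdeal, h]

end Fibre

section Torus

variable {n : ℕ}

instance : IsNoetherianRing (Laurent n) :=
  Algebra.FiniteType.isNoetherianRing ℤ (Laurent n)

/-- The field `ℂ`, regarded as an algebra over the Laurent polynomials through evaluation at the
point `t` of the torus. -/
def FibreField (_ : Torus n) : Type := ℂ

variable (t : Torus n)

instance : Field (FibreField t) := inferInstanceAs (Field ℂ)

instance : Algebra (Laurent n) (FibreField t) := (evalAt t).toRingHom.toAlgebra

/-- The value at `t` of the monomial `t₁^{v₁} ⋯ t_n^{v_n}`, in the field attached to `t`. -/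
def fibreCharacter : Zn n →* FibreField t := character t

theorem algebraMap_fibreField_single (v : Zn n) :
    algebraMap (Laurent n) (FibreField t) (MonoidAlgebra.single v 1) = fibreCharacter t v := by
  change evalAt t (MonoidAlgebra.single v 1) = character t v
  simp [evalAt]

theorem mem_charVariety_iff {M : Type*} [AddCommGroup M] [Module (Laurent n) M]
    [Module.Finite (Laurent n) M] {k : ℕ} :
    t ∈ charVariety M k ↔
      k ≤ Module.finrank (FibreField t) (M →ₗ[Laurent n] FibreField t) := by
  rw [← fittingIdeal_le_ker_iff]
  rfl

end Torus

/-! ### Commutators of generators -/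

section Commutators

variable {G : Type} [Group G]

/-- The commutator of two elements, as an element of the commutator subgroup. -/
def comm (g h : G) : commutator G :=
  ⟨⁅g, h⁆, Subgroup.commutator_mem_commutator (Subgroup.mem_top g) (Subgroup.mem_top h)⟩

theorem comm_eq_one {g h : G} (hgh : g * h = h * g) : comm g h = 1 :=
  Subtype.ext (commutatorElement_eq_one_iff_mul_comm.2 hgh)

theorem comm_inv (g h : G) : (comm g h)⁻¹ = comm h g := by
  ext
  simp [comm]

theorem comm_mul_left (a b h : G) :
    comm (a * b) h = MulAut.conjNormal (H := commutator G) a (comm b h) * comm a h := by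
  ext
  simp [comm, commutatorElement_def, mul_assoc]

variable {H : Subgroup (commutator G)}
  (hH : ∀ (g : G), ∀ x ∈ H, MulAut.conjNormal (H := commutator G) g x ∈ H)
  {S : Set G} (hS : Subgroup.closure S = ⊤)

include hH hS

theorem comm_mem_of_forall_generator {h : G} (h0 : ∀ s ∈ S, comm s h ∈ H) (g : G) :
    comm g h ∈ H := by
  have hg : g ∈ Subgroup.closure S := hS ▸ Subgroup.mem_top g
  induction hg using Subgroup.closure_induction with
  | mem x hx => exact h0 x hx
  | one => rw [comm_eq_one (by simp)]; exact one_mem _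
  | mul x y _ _ hx hy => rw [comm_mul_left]; exact mul_mem (hH _ _ hy) hx
  | inv x _ hx =>
    have := comm_mul_left x⁻¹ x h
    rw [inv_mul_cancel, comm_eq_one (by simp)] at this
    rw [eq_inv_of_mul_eq_one_right this.symm]
    exact inv_mem (hH _ _ hx)

/-- A conjugation invariant subgroup of `G'` that contains the commutators of generators of `G`
is all of `G'`. -/
theorem eq_top_of_comm_mem (h0 : ∀ s ∈ S, ∀ s' ∈ S, comm s s' ∈ H) : H = ⊤ := by
  have h1 (g h : G) : comm g h ∈ H := by
    refine comm_mem_of_forall_generator hH hS (fun s hs => ?_) g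
    rw [← comm_inv]
    exact inv_mem (comm_mem_of_forall_generator hH hS (fun s' hs' => h0 s' hs' s hs) h)
  have h2 : commutator G ≤ H.map (commutator G).subtype := by
    exact Subgroup.commutator_le.2 fun a _ b _ => ⟨comm a b, h1 a b, rfl⟩
  refine eq_top_iff.2 fun x _ => ?_
  obtain ⟨y, hy, hyx⟩ := h2 x.2
  rwa [← Subtype.ext hyx]

end Commutators

/-! ### Equivariant functions on the commutator subgroup -/

section Equivariant

variable {G : Type} [Group G] {K : Type*} [Field K] (χ : G →* K)

/-- The additive functions `G' → K` on which `G` acts, through conjugation of `G'`, by the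
character `χ`. These are the equivariant additive maps `G'/G'' → K`. -/
def equivariantHoms : Submodule K (commutator G → K) where
  carrier := {F | (∀ x y, F (x * y) = F x + F y) ∧
    ∀ g x, F (MulAut.conjNormal (H := commutator G) g x) = χ g * F x}
  zero_mem' := by simp
  add_mem' := by
    rintro F F' ⟨h1, h2⟩ ⟨h1', h2'⟩
    refine ⟨fun x y => ?_, fun g x => ?_⟩
    · simp only [Pi.add_apply, h1, h1']; ring
    · simp only [Pi.add_apply, h2, h2']; ring
  smul_mem' := by
    rintro c F ⟨h1, h2⟩
    refine ⟨fun x y => ?_, fun g x => ?_⟩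
    · simp only [Pi.smul_apply, h1, smul_eq_mul]; ring
    · simp only [Pi.smul_apply, h2, smul_eq_mul]; ring

variable {χ} {F : commutator G → K} (hF : F ∈ equivariantHoms χ)

/-- An equivariant function, as a homomorphism to the additive group of the field. -/
def equivariantHoms.toHom : commutator G →* Multiplicative K :=
  MonoidHom.mk' (fun x => Multiplicative.ofAdd (F x)) fun x y => congrArg _ (hF.1 x y)

include hF

theorem equivariantHoms.map_one : F 1 = 0 :=
  congrArg Multiplicative.toAdd (toHom hF).map_one

theorem equivariantHoms.map_inv (x : commutator G) : F x⁻¹ = -F x :=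
  congrArg Multiplicative.toAdd ((toHom hF).map_inv x)

theorem equivariantHoms.comm_eq_zero {g h : G} (hgh : g * h = h * g) : F (comm g h) = 0 := by
  rw [comm_eq_one hgh, map_one hF]

/-- For fixed `h`, the function `g ↦ F ([g, h])` is a crossed homomorphism. -/
theorem equivariantHoms.comm_mul (a b h : G) :
    F (comm (a * b) h) = F (comm a h) + χ a * F (comm b h) := by
  rw [comm_mul_left, hF.1, hF.2, add_comm]

theorem equivariantHoms.comm_swap (a b : G) : F (comm a b) = -F (comm b a) := by
  rw [← map_inv hF, comm_inv]

theorem equivariantHoms.conj_mem_ker (g : G) (x : commutator G)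
    (hx : x ∈ (toHom hF).ker) : MulAut.conjNormal (H := commutator G) g x ∈ (toHom hF).ker := by
  change F x = 0 at hx
  change F _ = 0
  rw [hF.2, hx, mul_zero]

/-- If `χ g₀ ≠ 1`, then an equivariant function is recovered from its values on the commutators
with `g₀`: for `x ∈ G'` one has `F ([x, g₀]) = (1 - χ g₀) F x`. -/
theorem equivariantHoms.eq_zero_of_ne_one {S : Set G}
    (hS : Subgroup.closure S = ⊤) {g₀ : G} (hg : χ g₀ ≠ 1)
    (h0 : ∀ s ∈ S, F (comm s g₀) = 0) : F = 0 := by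
  ext x
  have h1 : F (comm x g₀) = (1 - χ g₀) * F x := by
    have : comm (x : G) g₀ = x * MulAut.conjNormal (H := commutator G) g₀ x⁻¹ := by
      ext
      simp [comm, commutatorElement_def, mul_assoc]
    rw [this, hF.1, hF.2, map_inv hF]
    ring
  have h2 : F (comm x g₀) = 0 := comm_mem_of_forall_generator (conj_mem_ker hF) hS h0 x
  rw [h2] at h1
  simpa [sub_eq_zero, Ne.symm hg] using h1.symm

theorem equivariantHoms.eq_zero_of_comm {S : Set G} (hS : Subgroup.closure S = ⊤)
    (h0 : ∀ s ∈ S, ∀ s' ∈ S, F (comm s s') = 0) : F = 0 := by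
  have h1 := eq_top_of_comm_mem (conj_mem_ker hF) hS h0
  ext x
  have h2 : x ∈ (toHom hF).ker := h1 ▸ Subgroup.mem_top x
  exact h2

end Equivariant

/-! ### The Alexander invariant and equivariant functions -/

section Alexander

variable {G : Type} [Group G] {n : ℕ} (φ : G →* Zn n)

/-- The class in the `ℤ[G/G']`-module `G'/G''` of an element of the commutator subgroup. -/
def asModuleMk (x : commutator G) : (alexanderRep G).asModule :=
  (alexanderRep G).asModuleEquiv.symm (Additive.ofMul (Abelianization.of x))

theorem asModuleMk_surjective : Function.Surjective (asModuleMk (G := G)) := fun y =>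
  QuotientGroup.mk_surjective (Additive.toMul ((alexanderRep G).asModuleEquiv y))

theorem single_smul_asModuleMk (g : G) (c : ℤ) (x : commutator G) :
    (MonoidAlgebra.single (Abelianization.of g) c : MonoidAlgebra ℤ (Abelianization G)) •
      asModuleMk x = c • asModuleMk (MulAut.conjNormal (H := commutator G) g x) := by
  rw [Representation.single_smul]
  rfl

theorem groupRingMap_single (g : G) (c : ℤ) :
    groupRingMap φ (MonoidAlgebra.single (Abelianization.of g) c) =
      c • MonoidAlgebra.single (φ g) 1 := by
  change MonoidAlgebra.mapDomain _ _ = _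
  simp

/-- The class `1 ⊗ [x]` in the Alexander invariant of an element `x` of the commutator subgroup. -/
def alexanderMk (x : commutator G) : AlexanderInvariant φ :=
  letI := (groupRingMap φ).toAlgebra
  (1 : Laurent n) ⊗ₜ[MonoidAlgebra ℤ (Abelianization G)] asModuleMk x

/-- The map from the commutator subgroup to the Alexander invariant, as a homomorphism. -/
def alexanderHom : commutator G →* Multiplicative (AlexanderInvariant φ) :=
  MonoidHom.mk' (fun x => Multiplicative.ofAdd (alexanderMk φ x)) fun x y =>
    letI := (groupRingMap φ).toAlgebra
    TensorProduct.tmul_add (R := MonoidAlgebra ℤ (Abelianization G)) (1 : Laurent n)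
      (asModuleMk x) (asModuleMk y)

theorem alexanderMk_mul (x y : commutator G) :
    alexanderMk φ (x * y) = alexanderMk φ x + alexanderMk φ y :=
  (alexanderHom φ).map_mul x y

theorem alexanderMk_conj (g : G) (x : commutator G) :
    alexanderMk φ (MulAut.conjNormal (H := commutator G) g x) =
      (MonoidAlgebra.single (φ g) 1 : Laurent n) • alexanderMk φ x := by
  let := (groupRingMap φ).toAlgebra
  have h2 : (MonoidAlgebra.single (Abelianization.of g) 1 :
      MonoidAlgebra ℤ (Abelianization G)) • (1 : Laurent n) = MonoidAlgebra.single (φ g) 1 := by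
    rw [Algebra.smul_def, mul_one]
    exact (groupRingMap_single φ g 1).trans (one_smul _ _)
  have h3 : (1 : Laurent n) ⊗ₜ[MonoidAlgebra ℤ (Abelianization G)]
      asModuleMk (MulAut.conjNormal (H := commutator G) g x) =
        (MonoidAlgebra.single (φ g) 1 : Laurent n) • ((1 : Laurent n) ⊗ₜ asModuleMk x) := by
    rw [← one_smul ℤ (asModuleMk _), ← single_smul_asModuleMk, ← TensorProduct.smul_tmul, h2,
      TensorProduct.smul_tmul', smul_eq_mul, mul_one]
  exact h3

theorem span_range_alexanderMk :
    Submodule.span (Laurent n) (Set.range (alexanderMk φ)) = ⊤ := by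
  let := (groupRingMap φ).toAlgebra
  refine eq_top_iff.2 fun z _ => ?_
  induction z using TensorProduct.induction_on with
  | zero => exact zero_mem _
  | add x y hx hy => exact add_mem (hx trivial) (hy trivial)
  | tmul r y =>
    obtain ⟨x, rfl⟩ := asModuleMk_surjective y
    have h1 : r ⊗ₜ[MonoidAlgebra ℤ (Abelianization G)] asModuleMk x =
        r • ((1 : Laurent n) ⊗ₜ asModuleMk x) := by
      rw [TensorProduct.smul_tmul', smul_eq_mul, mul_one]
    have h2 : r • alexanderMk φ x ∈ Submodule.span (Laurent n) (Set.range (alexanderMk φ)) :=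
      Submodule.smul_mem _ r (Submodule.subset_span ⟨x, rfl⟩)
    exact Set.mem_of_eq_of_mem h1 h2

/-- If finitely many elements generate `G`, then the classes of their commutators generate the
Alexander invariant. -/
theorem finite_alexanderInvariant {S : Set G} (hfin : S.Finite)
    (hS : Subgroup.closure S = ⊤) : Module.Finite (Laurent n) (AlexanderInvariant φ) := by
  let N : Submodule (Laurent n) (AlexanderInvariant φ) :=
    Submodule.span _ ((fun p : G × G => alexanderMk φ (comm p.1 p.2)) '' (S ×ˢ S))
  suffices hN : N = ⊤ from ⟨hN ▸ Submodule.fg_span ((hfin.prod hfin).image _)⟩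
  have h1 : (AddSubgroup.toSubgroup N.toAddSubgroup).comap (alexanderHom φ) = ⊤ := by
    refine eq_top_of_comm_mem (fun g x hx => ?_) hS fun s hs s' hs' => ?_
    · change alexanderMk φ _ ∈ N
      rw [alexanderMk_conj]
      exact N.smul_mem _ hx
    · exact Submodule.subset_span ⟨(s, s'), ⟨hs, hs'⟩, rfl⟩
  rw [eq_top_iff, ← span_range_alexanderMk, Submodule.span_le]
  rintro _ ⟨x, rfl⟩
  have h2 : x ∈ (AddSubgroup.toSubgroup N.toAddSubgroup).comap (alexanderHom φ) :=
    h1 ▸ Subgroup.mem_top x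
  exact h2

variable (t : Torus n)

/-- The universal property of extension of scalars: an equivariant function on `G'` extends to the
Alexander invariant. -/
theorem exists_hom_of_mem_equivariantHoms {F : commutator G → FibreField t}
    (hF : F ∈ equivariantHoms ((fibreCharacter t).comp φ)) :
    ∃ f : AlexanderInvariant φ →ₗ[Laurent n] FibreField t, ∀ x, f (alexanderMk φ x) = F x := by
  let := (groupRingMap φ).toAlgebra
  let : Module (MonoidAlgebra ℤ (Abelianization G)) (FibreField t) :=
    Module.compHom _ (groupRingMap φ)
  have : IsScalarTower (MonoidAlgebra ℤ (Abelianization G)) (Laurent n) (FibreField t) :=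
    ⟨fun a b c => by
      rw [Algebra.smul_def a b, mul_smul]
      rfl⟩
  let F' : (alexanderRep G).asModule →+ FibreField t :=
    (MonoidHom.toAdditiveLeft (Abelianization.lift (equivariantHoms.toHom hF))).comp
      (alexanderRep G).asModuleEquiv.toAddMonoidHom
  have hF' (x : commutator G) : F' (asModuleMk x) = F x := rfl
  let f : (alexanderRep G).asModule →ₗ[MonoidAlgebra ℤ (Abelianization G)] FibreField t :=
    { toFun := F'
      map_add' := F'.map_add
      map_smul' a y := by
        rw [RingHom.id_apply]
        induction a using MonoidAlgebra.induction_linear with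
        | zero => rw [zero_smul, zero_smul, map_zero]
        | add a b ha hb => rw [add_smul, add_smul, map_add, ha, hb]
        | single g c =>
          obtain ⟨g, rfl⟩ := QuotientGroup.mk_surjective g
          obtain ⟨x, rfl⟩ := asModuleMk_surjective y
          have h1 : (MonoidAlgebra.single (Abelianization.of g) c :
              MonoidAlgebra ℤ (Abelianization G)) • F x =
                groupRingMap φ (MonoidAlgebra.single (Abelianization.of g) c) • F x := rfl
          refine (congrArg F' (single_smul_asModuleMk g c x)).trans (Eq.trans ?_ h1.symm)
          rw [map_zsmul, hF', hF.2, groupRingMap_single, smul_assoc,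
            Algebra.smul_def (MonoidAlgebra.single _ _), algebraMap_fibreField_single]
          rfl }
  refine ⟨LinearMap.liftBaseChange (Laurent n) f, fun x => ?_⟩
  exact (LinearMap.liftBaseChange_tmul (A := Laurent n) f 1 (asModuleMk x)).trans (one_smul _ _)

/-- The dual of the fibre of the Alexander invariant at `t` consists of the equivariant functions
on `G'`. -/
theorem finrank_alexander_hom :
    Module.finrank (FibreField t) (AlexanderInvariant φ →ₗ[Laurent n] FibreField t) =
      Module.finrank (FibreField t) (equivariantHoms ((fibreCharacter t).comp φ)) := by
  let E : (AlexanderInvariant φ →ₗ[Laurent n] FibreField t) →ₗ[FibreField t]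
      (commutator G → FibreField t) :=
    { toFun f x := f (alexanderMk φ x)
      map_add' _ _ := rfl
      map_smul' _ _ := rfl }
  have hinj : Function.Injective E := fun f g hfg =>
    LinearMap.ext_on_range (span_range_alexanderMk φ) (congrFun hfg)
  have hrange : LinearMap.range E = equivariantHoms ((fibreCharacter t).comp φ) := by
    ext F
    constructor
    · rintro ⟨f, rfl⟩
      refine ⟨fun x y => ?_, fun g x => ?_⟩
      · change f _ = f _ + f _
        rw [alexanderMk_mul, map_add]
      · change f _ = _ * f _
        rw [alexanderMk_conj, map_smul, Algebra.smul_def, algebraMap_fibreField_single]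
        rfl
    · intro hF
      obtain ⟨f, hf⟩ := exists_hom_of_mem_equivariantHoms φ t hF
      exact ⟨f, funext hf⟩
  rw [← LinearMap.finrank_range_of_inj hinj, hrange]

end Alexander

/-! ### Crossed homomorphisms -/

section Crossed

variable {ι K : Type*} [Field K] (τ : ι → K)

/-- The value of the crossed homomorphism with multipliers `τ` and values `v` on the generators,
on the product of a list of generators: `v_{i₁} + τ_{i₁} v_{i₂} + τ_{i₁} τ_{i₂} v_{i₃} + ⋯`. -/
def crossedSum : List ι → ((ι → K) →ₗ[K] K)
  | [] => 0
  | i :: L => LinearMap.proj i + τ i • crossedSum L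

theorem crossedSum_cons (i : ι) (L : List ι) (v : ι → K) :
    crossedSum τ (i :: L) v = v i + τ i * crossedSum τ L v := rfl

theorem crossedSum_eq_zero {L : List ι} {v : ι → K} (h : ∀ i ∈ L, v i = 0) :
    crossedSum τ L v = 0 := by
  induction L with
  | nil => rfl
  | cons i L ih =>
    rw [crossedSum_cons, h i (by simp), ih fun j hj => h j (by simp [hj])]
    simp

/-- If `v` vanishes on a list except possibly at one entry, then its crossed sum detects the
value there. -/
theorem eq_zero_of_crossedSum_eq_zero (hτ : ∀ i, τ i ≠ 0) {L : List ι} (hL : L.Nodup) {i : ι}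
    (hi : i ∈ L) {v : ι → K} (hv : ∀ j ∈ L, j ≠ i → v j = 0) (h : crossedSum τ L v = 0) :
    v i = 0 := by
  induction L with
  | nil => simp at hi
  | cons j L ih =>
    rw [List.nodup_cons] at hL
    rw [crossedSum_cons] at h
    by_cases hij : i = j
    · subst hij
      rw [crossedSum_eq_zero τ fun k hk =>
        hv k (by simp [hk]) fun hki => hL.1 (hki ▸ hk)] at h
      simpa using h
    · rw [hv j (by simp) (Ne.symm hij), zero_add] at h
      exact ih hL.2 (by simpa [hij] using hi) (fun k hk => hv k (by simp [hk]))
        ((mul_eq_zero.1 h).resolve_left (hτ j))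

theorem equivariantHoms.comm_list_prod {G : Type} [Group G] {χ : G →* K} {F : commutator G → K}
    (hF : F ∈ equivariantHoms χ) (s : ι → G) (h : G) (L : List ι) :
    F (comm (L.map s).prod h) =
      crossedSum (fun i => χ (s i)) L (fun i => F (comm (s i) h)) := by
  induction L with
  | nil => exact comm_eq_zero hF (by simp)
  | cons i L ih => rw [List.map_cons, List.prod_cons, comm_mul hF, ih, crossedSum_cons]

theorem character_commutator {G : Type} [Group G] (χ : G →* K) (x : commutator G) :
    χ x = 1 := by
  have h : (x : G) ∈ χ.toHomUnits.ker := Abelianization.commutator_subset_ker _ x.2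
  simpa using congrArg Units.val (MonoidHom.mem_ker.1 h)

/-- A crossed homomorphism restricts to an equivariant function on the commutator subgroup. -/
theorem crossedHom_mem_equivariantHoms {G : Type} [Group G] {χ : G →* K} {d : G → K}
    (hd : ∀ g h, d (g * h) = d g + χ g * d h) :
    (fun x : commutator G => d x) ∈ equivariantHoms χ := by
  have h1 : d 1 = 0 := by simpa using hd 1 1
  refine ⟨fun x y => ?_, fun g x => ?_⟩
  · change d (x * y) = _
    rw [hd, character_commutator, one_mul]
  · have h2 := hd (g * x * g⁻¹) g
    rw [inv_mul_cancel_right, hd, map_mul, map_mul, character_commutator] at h2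
    have h3 : χ g * χ g⁻¹ = 1 := by rw [← map_mul, mul_inv_cancel, map_one]
    change d (g * x * g⁻¹) = _
    linear_combination (-1 : K) * h2 - d g * h3

theorem crossedHom_commutator {G : Type} [Group G] {χ : G →* K} {d : G → K}
    (hd : ∀ g h, d (g * h) = d g + χ g * d h) (a b : G) :
    d ⁅a, b⁆ = (1 - χ b) * d a - (1 - χ a) * d b := by
  have h1 := hd ⁅a, b⁆ (b * a)
  have h2 : ⁅a, b⁆ * (b * a) = a * b := by simp [commutatorElement_def, mul_assoc]
  rw [h2, show χ ⁅a, b⁆ = 1 from character_commutator χ (comm a b), hd, hd] at h1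
  linear_combination -h1

end Crossed

/-! ### The local groups at a nontrivial character -/

section LocalGroup

variable {n : ℕ} {X : Finset (Fin n)}

theorem of_mul_of_comm {j : Fin n} (hj : j ∉ X) (i : Fin n) :
    (PresentedGroup.of i : LocalGroup X) * PresentedGroup.of j =
      PresentedGroup.of j * PresentedGroup.of i := by
  have h : (PresentedGroup.mk (localRels X)) ⁅FreeGroup.of j, FreeGroup.of i⁆ = 1 :=
    PresentedGroup.one_of_mem (Or.inr ⟨j, i, hj, rfl⟩)
  rw [map_commutatorElement, commutatorElement_eq_one_iff_mul_comm] at h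
  exact h.symm

/-- The element `γ_X` of the local group. -/
def localGamma (X : Finset (Fin n)) : LocalGroup X := PresentedGroup.mk _ (gammaX X)

theorem localGamma_eq_prod :
    localGamma X = ((X.sort (· ≤ ·)).map (PresentedGroup.of : Fin n → LocalGroup X)).prod := by
  rw [localGamma, gammaX, map_list_prod, List.map_map]
  rfl

theorem localGamma_comm_of_mem {i : Fin n} (hi : i ∈ X) :
    localGamma X * PresentedGroup.of i = PresentedGroup.of i * localGamma X := by
  have h : (PresentedGroup.mk (localRels X)) ⁅gammaX X, FreeGroup.of i⁆ = 1 :=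
    PresentedGroup.one_of_mem (Or.inl ⟨i, hi, rfl⟩)
  rw [map_commutatorElement, commutatorElement_eq_one_iff_mul_comm] at h
  exact h

theorem localGamma_comm (i : Fin n) :
    localGamma X * PresentedGroup.of i = PresentedGroup.of i * localGamma X := by
  by_cases hi : i ∈ X
  · exact localGamma_comm_of_mem hi
  · have h (x : LocalGroup X) : Commute x (PresentedGroup.of i) := by
      have hx : x ∈ Subgroup.closure (Set.range (PresentedGroup.of (rels := localRels X))) := by
        rw [PresentedGroup.closure_range_of]
        exact Subgroup.mem_top x
      induction hx using Subgroup.closure_induction with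
      | mem x hx =>
        obtain ⟨k, rfl⟩ := hx
        exact of_mul_of_comm hi k
      | one => exact Commute.one_left _
      | mul x y _ _ hx hy => exact hx.mul_left hy
      | inv x _ hx => exact hx.inv_left
    exact h _

variable {K : Type*} [Field K] (χ : LocalGroup X →* K)

theorem character_ne_zero {G : Type} [Group G] (χ : G →* K) (g : G) : χ g ≠ 0 :=
  (χ.toHomUnits g).ne_zero

theorem character_localGamma :
    χ (localGamma X) = ∏ i ∈ X, χ (PresentedGroup.of i) := by
  rw [localGamma_eq_prod, map_list_prod, List.map_map, ← Finset.prod_map_toList,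
    ((Finset.sort_perm_toList X (· ≤ ·)).map _).prod_eq]
  rfl

theorem equivariantHoms_local_eq_bot
    (h : ¬(∏ i ∈ X, χ (PresentedGroup.of i) = 1 ∧ ∀ j, j ∉ X → χ (PresentedGroup.of j) = 1)) :
    equivariantHoms χ = ⊥ := by
  have hS := PresentedGroup.closure_range_of (localRels X)
  refine (Submodule.eq_bot_iff _).2 fun F hF => ?_
  -- One of the central elements `γ_X` and `γ_j`, `j ∉ X`, acts nontrivially.
  by_cases hX : ∏ i ∈ X, χ (PresentedGroup.of i) = 1
  · have : ∃ j, j ∉ X ∧ χ (PresentedGroup.of j) ≠ 1 := by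
      by_contra! hj
      exact h ⟨hX, hj⟩
    obtain ⟨j, hj, hj1⟩ := this
    refine equivariantHoms.eq_zero_of_ne_one hF hS hj1 ?_
    rintro _ ⟨i, rfl⟩
    exact equivariantHoms.comm_eq_zero hF (of_mul_of_comm hj i)
  · rw [← character_localGamma] at hX
    refine equivariantHoms.eq_zero_of_ne_one hF hS hX ?_
    rintro _ ⟨i, rfl⟩
    exact equivariantHoms.comm_eq_zero hF (localGamma_comm i).symm

/-- A crossed homomorphism on the local group, constructed from its values on the generators as
the translation part of an action on `K` by affine maps. -/
theorem exists_crossedHom (hX : χ (localGamma X) = 1)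
    (h1 : ∀ j, j ∉ X → χ (PresentedGroup.of j) = 1) {v : Fin n → K} (hv : ∀ j, j ∉ X → v j = 0)
    (hvX : crossedSum (fun i => χ (PresentedGroup.of i)) (X.sort (· ≤ ·)) v = 0) :
    ∃ d : LocalGroup X → K, (∀ g h, d (g * h) = d g + χ g * d h) ∧
      ∀ i, d (PresentedGroup.of i) = v i := by
  let f (i : Fin n) : Equiv.Perm K :=
    (Equiv.mulLeft₀ (χ (PresentedGroup.of i)) (character_ne_zero χ _)).trans (Equiv.addLeft (v i))
  have hf (i : Fin n) (z : K) : f i z = v i + χ (PresentedGroup.of i) * z := rfl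
  have hlist (L : List (Fin n)) (z : K) : FreeGroup.lift f (L.map FreeGroup.of).prod z =
      crossedSum (fun i => χ (PresentedGroup.of i)) L v +
        χ ((L.map PresentedGroup.of).prod) * z := by
    induction L with
    | nil => simp [crossedSum]
    | cons i L ih =>
      rw [List.map_cons, List.prod_cons, map_mul, Equiv.Perm.mul_apply, ih, FreeGroup.lift_apply_of,
        hf, List.map_cons, List.prod_cons, map_mul, crossedSum_cons]
      ring
  have hrel : ∀ r ∈ localRels X, FreeGroup.lift f r = 1 := by
    rintro r (⟨i, -, rfl⟩ | ⟨j, i, hj, rfl⟩)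
    · have : FreeGroup.lift f (gammaX X) = 1 := by
        ext z
        rw [gammaX, hlist, hvX, ← localGamma_eq_prod, hX]
        simp
      rw [map_commutatorElement, this, commutatorElement_one_left]
    · have : f j = 1 := by
        ext z
        rw [hf, h1 j hj, hv j hj]
        simp
      rw [map_commutatorElement, FreeGroup.lift_apply_of, this, commutatorElement_one_left]
  let ρ : LocalGroup X →* Equiv.Perm K := PresentedGroup.toGroup hrel
  have hρ (g : LocalGroup X) : ∀ z, ρ g z = ρ g 0 + χ g * z := by
    have hg : g ∈ Subgroup.closure (Set.range (PresentedGroup.of (rels := localRels X))) := by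
      rw [PresentedGroup.closure_range_of]
      exact Subgroup.mem_top g
    induction hg using Subgroup.closure_induction with
    | mem x hx =>
      obtain ⟨i, rfl⟩ := hx
      intro z
      simp only [ρ, PresentedGroup.toGroup.of, hf]
      ring
    | one => simp
    | mul x y _ _ hx hy =>
      intro z
      rw [map_mul, Equiv.Perm.mul_apply, Equiv.Perm.mul_apply, hx, hy, hx (ρ y 0), map_mul]
      ring
    | inv x _ hx =>
      intro z
      have h2 : χ x * χ x⁻¹ = 1 := by rw [← map_mul, mul_inv_cancel, map_one]
      rw [map_inv, Equiv.Perm.inv_eq_iff_eq, hx, mul_add, ← add_assoc, ← hx, ← mul_assoc, h2,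
        one_mul, ← Equiv.Perm.mul_apply, mul_inv_cancel, Equiv.Perm.one_apply, zero_add]
  refine ⟨fun g => ρ g 0, fun g h => ?_, fun i => ?_⟩
  · change ρ (g * h) 0 = _
    rw [map_mul, Equiv.Perm.mul_apply, hρ]
  · simp [ρ, PresentedGroup.toGroup.of, hf]

/-- At a nontrivial point of the local torus, the equivariant functions are given by the values
`F ([γ_i, γ_{i₀}])` for `i ∈ X ∖ i₀`, subject to a single linear relation from `γ_X`.
The hypotheses force `|X| ≥ 2`, so the subtraction is not truncated. -/
theorem finrank_equivariantHoms_local (hX : ∏ i ∈ X, χ (PresentedGroup.of i) = 1)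
    (h1 : ∀ j, j ∉ X → χ (PresentedGroup.of j) = 1) {i₀ : Fin n}
    (hne : χ (PresentedGroup.of i₀) ≠ 1) :
    Module.finrank K (equivariantHoms χ) = X.card - 2 := by
  rw [← character_localGamma] at hX
  have hi₀ : i₀ ∈ X := by
    by_contra h
    exact hne (h1 i₀ h)
  have hS := PresentedGroup.closure_range_of (localRels X)
  let Y := X.erase i₀
  let E : equivariantHoms χ →ₗ[K] (Y → K) :=
    { toFun F i := F.1 (comm (PresentedGroup.of i.1) (PresentedGroup.of i₀))
      map_add' _ _ := rfl
      map_smul' _ _ := rfl }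
  let ext : (Y → K) →ₗ[K] (Fin n → K) := Function.ExtendByZero.linearMap K Subtype.val
  have hext (w : Y → K) (i : Y) : ext w i = w i := Subtype.val_injective.extend_apply _ _ _
  have hext0 (w : Y → K) {i : Fin n} (hi : i ∉ Y) : ext w i = 0 :=
    Function.extend_apply' _ _ _ (by rintro ⟨j, rfl⟩; exact hi j.2)
  let l : (Y → K) →ₗ[K] K :=
    crossedSum (fun i => χ (PresentedGroup.of i)) (X.sort (· ≤ ·)) ∘ₗ ext
  have hval (F : equivariantHoms χ) : ext (E F) = fun i =>
      F.1 (comm (PresentedGroup.of i) (PresentedGroup.of i₀)) := by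
    funext i
    by_cases hi : i ∈ Y
    · exact hext _ ⟨i, hi⟩
    · rw [hext0 _ hi]
      by_cases hii : i = i₀
      · rw [hii]
        exact (equivariantHoms.comm_eq_zero F.2 rfl).symm
      · have : i ∉ X := fun h => hi (Finset.mem_erase.2 ⟨hii, h⟩)
        exact (equivariantHoms.comm_eq_zero F.2 (of_mul_of_comm this i₀).symm).symm
  have hinj : Function.Injective E := by
    rw [← LinearMap.ker_eq_bot, LinearMap.ker_eq_bot']
    intro F hF
    ext1
    refine equivariantHoms.eq_zero_of_ne_one F.2 hS hne ?_
    rintro _ ⟨i, rfl⟩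
    have := congrFun (hval F) i
    rw [hF, map_zero] at this
    exact this.symm
  have hrange : LinearMap.range E = LinearMap.ker l := by
    ext w
    constructor
    · rintro ⟨F, rfl⟩
      change crossedSum _ _ (ext (E F)) = 0
      rw [hval, ← equivariantHoms.comm_list_prod F.2, ← localGamma_eq_prod]
      exact equivariantHoms.comm_eq_zero F.2 (localGamma_comm i₀)
    · intro hw
      obtain ⟨d, hd, hdv⟩ := exists_crossedHom χ hX h1 (v := ext w)
        (fun j hj => hext0 w fun h => hj (Finset.mem_of_mem_erase h)) hw
      refine ⟨(1 - χ (PresentedGroup.of i₀))⁻¹ • ⟨_, crossedHom_mem_equivariantHoms hd⟩, ?_⟩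
      rw [map_smul]
      funext i
      change (1 - χ (PresentedGroup.of i₀))⁻¹ * d ⁅PresentedGroup.of i.1, PresentedGroup.of i₀⁆ = _
      rw [crossedHom_commutator hd, hdv, hdv, hext0 w (Finset.notMem_erase _ _), hext, mul_zero,
        sub_zero, inv_mul_cancel_left₀ (sub_ne_zero.2 hne.symm)]
  -- As `χ γ_X = 1`, the set `X` has a second element, and the relation is nontrivial there.
  have hY : Y.Nonempty := by
    by_contra hY
    rw [Finset.not_nonempty_iff_eq_empty, Finset.erase_eq_empty_iff] at hY
    rcases hY with hY | hY
    · simp [hY] at hi₀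
    · rw [character_localGamma, Finset.prod_congr hY fun _ _ => rfl, Finset.prod_singleton] at hX
      exact hne hX
  have hl : l ≠ 0 := by
    obtain ⟨i, hi⟩ := hY
    intro hl
    have h2 := LinearMap.congr_fun hl (Pi.single ⟨i, hi⟩ 1)
    have h3 := eq_zero_of_crossedSum_eq_zero _ (fun j => character_ne_zero χ (PresentedGroup.of j))
      (Finset.sort_nodup X (· ≤ ·))
      ((Finset.mem_sort _).2 (Finset.mem_of_mem_erase hi)) (fun j _ hji => ?_) h2
    · rw [hext _ ⟨i, hi⟩, Pi.single_eq_same] at h3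
      exact one_ne_zero h3
    · by_cases hj : j ∈ Y
      · rw [hext _ ⟨j, hj⟩, Pi.single_eq_of_ne]
        simpa using hji
      · exact hext0 _ hj
  have h2 := Module.Dual.finrank_ker_add_one_of_ne_zero (f := l) hl
  rw [← hrange, LinearMap.finrank_range_of_inj hinj, Module.finrank_fintype_fun_eq_card,
    Fintype.card_coe, Finset.card_erase_of_mem hi₀] at h2
  omega

end LocalGroup

/-! ### The local groups at the trivial character -/

section Heisenberg

variable {K V : Type*} [Field K] [AddCommGroup V] [Module K V]

/-- The Heisenberg group of a bilinear form `β` on `V`: the set `K × V` with the product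
`(z, u) (z', u') = (z + z' + β u u', u + u')`. -/
@[ext]
structure Heisenberg (β : V →ₗ[K] V →ₗ[K] K) where
  /-- The central coordinate. -/
  center : K
  /-- The coordinate in the vector space. -/
  vector : V

namespace Heisenberg

variable {β : V →ₗ[K] V →ₗ[K] K}

instance : Group (Heisenberg β) where
  mul x y := ⟨x.center + y.center + β x.vector y.vector, x.vector + y.vector⟩
  one := ⟨0, 0⟩
  inv x := ⟨-x.center + β x.vector x.vector, -x.vector⟩
  mul_assoc x y z := by
    refine Heisenberg.ext ?_ (add_assoc _ _ _)
    change x.center + y.center + β x.vector y.vector + z.center + β (x.vector + y.vector) z.vector =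
      x.center + (y.center + z.center + β y.vector z.vector) + β x.vector (y.vector + z.vector)
    rw [map_add, map_add, LinearMap.add_apply]
    ring
  one_mul x := by
    refine Heisenberg.ext ?_ (zero_add _)
    change 0 + x.center + β 0 x.vector = x.center
    simp
  mul_one x := by
    refine Heisenberg.ext ?_ (add_zero _)
    change x.center + 0 + β x.vector 0 = x.center
    simp
  inv_mul_cancel x := by
    refine Heisenberg.ext ?_ (neg_add_cancel _)
    change -x.center + β x.vector x.vector + x.center + β (-x.vector) x.vector = 0
    simp

theorem center_mul (x y : Heisenberg β) :
    (x * y).center = x.center + y.center + β x.vector y.vector := rfl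

theorem vector_mul (x y : Heisenberg β) : (x * y).vector = x.vector + y.vector := rfl

theorem mul_comm_of_eq {x y : Heisenberg β} (h : β x.vector y.vector = β y.vector x.vector) :
    x * y = y * x := by
  ext
  · rw [center_mul, center_mul, h, add_comm x.center]
  · exact add_comm _ _

/-- The projection of the Heisenberg group to the vector space. -/
def vectorHom : Heisenberg β →* Multiplicative V :=
  MonoidHom.mk' (fun x => Multiplicative.ofAdd x.vector) fun _ _ => rfl

theorem vector_commutator {G : Type} [Group G] (ρ : G →* Heisenberg β) (x : commutator G) :
    (ρ x).vector = 0 := by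
  have h : (x : G) ∈ (vectorHom.comp ρ).ker := Abelianization.commutator_subset_ker _ x.2
  exact congrArg Multiplicative.toAdd (MonoidHom.mem_ker.1 h)

theorem center_commutator (x y : Heisenberg β) :
    ⁅x, y⁆.center = β x.vector y.vector - β y.vector x.vector := by
  have h2 : ⁅x, y⁆ * (y * x) = x * y := by simp [commutatorElement_def, mul_assoc]
  have h3 : vectorHom ⁅x, y⁆ = 1 := by
    rw [map_commutatorElement, commutatorElement_eq_one_iff_mul_comm, mul_comm]
  have h1 := congrArg center h2
  rw [center_mul, center_mul, center_mul, show ⁅x, y⁆.vector = 0 from h3, map_zero,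
    LinearMap.zero_apply] at h1
  linear_combination h1

/-- A homomorphism to a Heisenberg group restricts to an invariant function on the commutator
subgroup, which is mapped to the center. -/
theorem center_mem_equivariantHoms {G : Type} [Group G] {χ : G →* K} (hχ : ∀ g, χ g = 1)
    (ρ : G →* Heisenberg β) :
    (fun x : commutator G => (ρ x).center) ∈ equivariantHoms χ := by
  refine ⟨fun x y => ?_, fun g x => ?_⟩
  · change (ρ (x * y)).center = _
    rw [map_mul, center_mul, vector_commutator, map_zero, LinearMap.zero_apply, add_zero]
  · change (ρ (g * x * g⁻¹)).center = χ g * (ρ x).center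
    have h : ρ g * ρ x = ρ x * ρ g := mul_comm_of_eq (by simp [vector_commutator])
    rw [map_mul, map_mul, h, map_inv, mul_inv_cancel_right, hχ, one_mul]

end Heisenberg

end Heisenberg

section Trivial

variable {n : ℕ}

/-- The pairs of elements `i < j` of a finite set. -/
def orderedPairs (Y : Finset (Fin n)) : Finset (Fin n × Fin n) :=
  (Y ×ˢ Y).filter fun p => p.1 < p.2

theorem mem_orderedPairs {Y : Finset (Fin n)} {p : Fin n × Fin n} :
    p ∈ orderedPairs Y ↔ (p.1 ∈ Y ∧ p.2 ∈ Y) ∧ p.1 < p.2 := by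
  rw [orderedPairs, Finset.mem_filter, Finset.mem_product]

theorem card_orderedPairs (Y : Finset (Fin n)) : (orderedPairs Y).card = Y.card.choose 2 := by
  rw [← Finset.card_powersetCard]
  refine Finset.card_bij (fun p _ => {p.1, p.2}) ?_ ?_ ?_
  · intro p hp
    obtain ⟨⟨h1, h2⟩, h3⟩ := mem_orderedPairs.1 hp
    rw [Finset.mem_powersetCard]
    exact ⟨Finset.insert_subset h1 (Finset.singleton_subset_iff.2 h2), Finset.card_pair h3.ne⟩
  · rintro ⟨a, b⟩ hp ⟨c, d⟩ hq h
    have h1 := (mem_orderedPairs.1 hp).2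
    have h2 := (mem_orderedPairs.1 hq).2
    have ha : a ∈ ({c, d} : Finset (Fin n)) := h ▸ Finset.mem_insert_self a _
    have hb : b ∈ ({c, d} : Finset (Fin n)) := h ▸ by simp
    simp only [Finset.mem_insert, Finset.mem_singleton, Prod.mk.injEq] at *
    omega
  · intro s hs
    rw [Finset.mem_powersetCard, Finset.card_eq_two] at hs
    obtain ⟨hs, a, b, hab, rfl⟩ := hs
    have ha : a ∈ Y := hs (by simp)
    have hb : b ∈ Y := hs (by simp)
    rcases lt_or_gt_of_ne hab with h | h
    · exact ⟨(a, b), mem_orderedPairs.2 ⟨⟨ha, hb⟩, h⟩, rfl⟩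
    · exact ⟨(b, a), mem_orderedPairs.2 ⟨⟨hb, ha⟩, h⟩, Finset.pair_comm b a⟩

variable {K : Type*} [Field K]

/-- The bilinear form `∑ c_{ij} (x_i - x_{i₀}) ⊗ (x_j - x_{i₀})`, the sum over a set of pairs. -/
def relativeForm (P : Finset (Fin n × Fin n)) (i₀ : Fin n) (c : P → K) :
    (Fin n → K) →ₗ[K] (Fin n → K) →ₗ[K] K :=
  LinearMap.mk₂ K (fun u v => ∑ p : P, c p * (u p.1.1 - u i₀) * (v p.1.2 - v i₀))
    (fun u u' v => by
      rw [← Finset.sum_add_distrib]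
      exact Finset.sum_congr rfl fun p _ => by simp only [Pi.add_apply]; ring)
    (fun a u v => by
      rw [Finset.smul_sum]
      exact Finset.sum_congr rfl fun p _ => by simp only [Pi.smul_apply, smul_eq_mul]; ring)
    (fun u v v' => by
      rw [← Finset.sum_add_distrib]
      exact Finset.sum_congr rfl fun p _ => by simp only [Pi.add_apply]; ring)
    (fun a u v => by
      rw [Finset.smul_sum]
      exact Finset.sum_congr rfl fun p _ => by simp only [Pi.smul_apply, smul_eq_mul]; ring)

theorem relativeForm_apply (P : Finset (Fin n × Fin n)) (i₀ : Fin n) (c : P → K)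
    (u v : Fin n → K) : relativeForm P i₀ c u v =
      ∑ p : P, c p * (u p.1.1 - u i₀) * (v p.1.2 - v i₀) := rfl

theorem relativeForm_single {P : Finset (Fin n × Fin n)} {i₀ : Fin n} (c : P → K)
    {i j : Fin n} (hi : i ≠ i₀) (hj : j ≠ i₀) :
    relativeForm P i₀ c (Pi.single i 1) (Pi.single j 1) =
      if h : (i, j) ∈ P then c ⟨(i, j), h⟩ else 0 := by
  rw [relativeForm_apply]
  have h0 (p : P) (hp : p.1 ≠ (i, j)) : c p * ((Pi.single i 1 : Fin n → K) p.1.1 -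
      (Pi.single i 1 : Fin n → K) i₀) * ((Pi.single j 1 : Fin n → K) p.1.2 -
        (Pi.single j 1 : Fin n → K) i₀) = 0 := by
    rw [Pi.single_eq_of_ne hi.symm, Pi.single_eq_of_ne hj.symm]
    by_cases h1 : p.1.1 = i
    · have h2 : p.1.2 ≠ j := fun h2 => hp (Prod.ext h1 h2)
      rw [Pi.single_eq_of_ne h2]
      ring
    · rw [Pi.single_eq_of_ne h1]
      ring
  split_ifs with h
  · rw [Finset.sum_eq_single ⟨(i, j), h⟩ (fun p _ hp => h0 p fun hp' => hp (Subtype.ext hp'))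
      (by simp)]
    simp [Pi.single_eq_of_ne hi.symm, Pi.single_eq_of_ne hj.symm]
  · exact Finset.sum_eq_zero fun p _ => h0 p fun hp => h (hp ▸ p.2)

variable {X : Finset (Fin n)}

/-- A bilinear form on `K^n` whose radical contains the basis vectors outside of `X` and the sum
of those in `X` gives a homomorphism from the local group to the Heisenberg group. -/
theorem exists_heisenbergHom {β : (Fin n → K) →ₗ[K] (Fin n → K) →ₗ[K] K}
    (hβl : ∀ j ∉ X, ∀ v, β (Pi.single j 1) v = 0) (hβr : ∀ j ∉ X, ∀ v, β v (Pi.single j 1) = 0)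
    (hβXl : ∀ v, β (∑ i ∈ X, Pi.single i 1) v = 0)
    (hβXr : ∀ v, β v (∑ i ∈ X, Pi.single i 1) = 0) :
    ∃ ρ : LocalGroup X →* Heisenberg β, ∀ i, (ρ (PresentedGroup.of i)).vector = Pi.single i 1 := by
  let f (i : Fin n) : Heisenberg β := ⟨0, Pi.single i 1⟩
  have hX : (FreeGroup.lift f (gammaX X)).vector = ∑ i ∈ X, Pi.single i 1 := by
    have h1 (L : List (Fin n)) : (FreeGroup.lift f (L.map FreeGroup.of).prod).vector =
        (L.map fun i => (Pi.single i 1 : Fin n → K)).sum := by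
      induction L with
      | nil => rfl
      | cons i L ih =>
        rw [List.map_cons, List.prod_cons, map_mul, Heisenberg.vector_mul, ih,
          FreeGroup.lift_apply_of, List.map_cons, List.sum_cons]
    rw [gammaX, h1, ((Finset.sort_perm_toList X (· ≤ ·)).map _).sum_eq, Finset.sum_map_toList]
  have hrel : ∀ r ∈ localRels X, FreeGroup.lift f r = 1 := by
    rintro r (⟨i, -, rfl⟩ | ⟨j, i, hj, rfl⟩) <;>
    rw [map_commutatorElement, commutatorElement_eq_one_iff_mul_comm] <;>
    apply Heisenberg.mul_comm_of_eq
    · rw [hX, hβXl, hβXr]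
    · rw [FreeGroup.lift_apply_of, FreeGroup.lift_apply_of, hβl j hj, hβr j hj]
  exact ⟨PresentedGroup.toGroup hrel, fun i => by rw [PresentedGroup.toGroup.of]⟩

/-- At the trivial character, the equivariant functions correspond to the alternating forms on the
quotient of `K^n` by the basis vectors outside of `X` and the sum of those in `X`, and such a form
is given by its values on pairs of basis vectors from `X ∖ i₀`. -/
theorem finrank_equivariantHoms_local_one (hX : X.Nonempty) {χ : LocalGroup X →* K}
    (hχ : ∀ g, χ g = 1) :
    Module.finrank K (equivariantHoms χ) = (X.card - 1).choose 2 := by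
  obtain ⟨i₀, hi₀⟩ := hX
  let Y := X.erase i₀
  let P := orderedPairs Y
  let E : equivariantHoms χ →ₗ[K] (P → K) :=
    { toFun F p := F.1 (comm (PresentedGroup.of p.1.1) (PresentedGroup.of p.1.2))
      map_add' _ _ := rfl
      map_smul' _ _ := rfl }
  have hinj : Function.Injective E := by
    rw [← LinearMap.ker_eq_bot, LinearMap.ker_eq_bot']
    rintro ⟨F, hF⟩ hEF
    refine Subtype.ext (show F = 0 from ?_)
    have hY {i j : Fin n} (hi : i ∈ Y) (hj : j ∈ Y) :
        F (comm (PresentedGroup.of i) (PresentedGroup.of j)) = 0 := by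
      rcases lt_trichotomy i j with h | h | h
      · exact congrFun hEF ⟨(i, j), mem_orderedPairs.2 ⟨⟨hi, hj⟩, h⟩⟩
      · rw [h]
        exact equivariantHoms.comm_eq_zero hF rfl
      · rw [equivariantHoms.comm_swap hF, neg_eq_zero]
        exact congrFun hEF ⟨(j, i), mem_orderedPairs.2 ⟨⟨hj, hi⟩, h⟩⟩
    -- The relation `[γ_X, γ_j] = 1` takes care of the index `i₀`.
    have hi₀j {j : Fin n} (hj : j ∈ Y) :
        F (comm (PresentedGroup.of i₀) (PresentedGroup.of j)) = 0 := by
      have h1 := equivariantHoms.comm_eq_zero hF (localGamma_comm (X := X) j)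
      rw [localGamma_eq_prod, equivariantHoms.comm_list_prod hF] at h1
      exact eq_zero_of_crossedSum_eq_zero _
        (fun k => character_ne_zero χ (PresentedGroup.of k)) (Finset.sort_nodup X (· ≤ ·))
        ((Finset.mem_sort _).2 hi₀)
        (fun k hk hki => hY (Finset.mem_erase.2 ⟨hki, (Finset.mem_sort _).1 hk⟩) hj) h1
    refine equivariantHoms.eq_zero_of_comm hF (PresentedGroup.closure_range_of (localRels X)) ?_
    rintro _ ⟨i, rfl⟩ _ ⟨j, rfl⟩
    by_cases hi : i ∈ X
    · by_cases hj : j ∈ X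
      · by_cases hii : i = i₀
        · by_cases hji : j = i₀
          · rw [hii, hji]
            exact equivariantHoms.comm_eq_zero hF rfl
          · rw [hii]
            exact hi₀j (Finset.mem_erase.2 ⟨hji, hj⟩)
        · by_cases hji : j = i₀
          · rw [hji, equivariantHoms.comm_swap hF, neg_eq_zero]
            exact hi₀j (Finset.mem_erase.2 ⟨hii, hi⟩)
          · exact hY (Finset.mem_erase.2 ⟨hii, hi⟩) (Finset.mem_erase.2 ⟨hji, hj⟩)
      · exact equivariantHoms.comm_eq_zero hF (of_mul_of_comm hj i)
    · exact equivariantHoms.comm_eq_zero hF (of_mul_of_comm hi j).symm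
  have hsurj : Function.Surjective E := by
    intro c
    have hP (p : P) : p.1.1 ∈ Y ∧ p.1.2 ∈ Y := (mem_orderedPairs.1 p.2).1
    have hX (i : Fin n) (hi : i ∈ X) : (∑ j ∈ X, Pi.single j 1 : Fin n → K) i = 1 := by
      rw [Finset.sum_apply, Finset.sum_pi_single, if_pos hi]
    have hne {i j : Fin n} (hj : j ∉ X) (hi : i ∈ X) : (Pi.single j 1 : Fin n → K) i = 0 :=
      Pi.single_eq_of_ne (fun h : i = j => hj (h ▸ hi)) 1
    obtain ⟨ρ, hρ⟩ := exists_heisenbergHom (X := X) (β := relativeForm P i₀ c)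
      (fun j hj v => Finset.sum_eq_zero fun p _ => by
        rw [hne hj hi₀, hne hj (Finset.mem_of_mem_erase (hP p).1)]; ring)
      (fun j hj v => Finset.sum_eq_zero fun p _ => by
        rw [hne hj hi₀, hne hj (Finset.mem_of_mem_erase (hP p).2)]; ring)
      (fun v => Finset.sum_eq_zero fun p _ => by
        rw [hX _ hi₀, hX _ (Finset.mem_of_mem_erase (hP p).1)]; ring)
      (fun v => Finset.sum_eq_zero fun p _ => by
        rw [hX _ hi₀, hX _ (Finset.mem_of_mem_erase (hP p).2)]; ring)
    refine ⟨⟨_, Heisenberg.center_mem_equivariantHoms hχ ρ⟩, ?_⟩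
    funext p
    have h1 := Finset.ne_of_mem_erase (hP p).1
    have h2 := Finset.ne_of_mem_erase (hP p).2
    have h3 : (p.1.2, p.1.1) ∉ P := fun h =>
      lt_asymm (mem_orderedPairs.1 h).2 (mem_orderedPairs.1 p.2).2
    change (ρ ⁅_, _⁆).center = _
    rw [map_commutatorElement, Heisenberg.center_commutator, hρ, hρ, relativeForm_single c h1 h2,
      relativeForm_single c h2 h1, dif_pos p.2, dif_neg h3, sub_zero]
  rw [(LinearEquiv.ofBijective E ⟨hinj, hsurj⟩).finrank_eq, Module.finrank_fintype_fun_eq_card,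
    Fintype.card_coe, card_orderedPairs, Finset.card_erase_of_mem hi₀]

end Trivial

/-! ### Characteristic varieties of the local groups -/

section LocalVariety

variable {n : ℕ} (X : Finset (Fin n))

instance : Module.Finite (Laurent n) (LocalAlexander X) :=
  finite_alexanderInvariant _ (Set.finite_range PresentedGroup.of)
    (PresentedGroup.closure_range_of (localRels X))

/-- The dimension of the (dual of the) fibre at `t` of the local Alexander invariant. -/
def localDepth (t : Torus n) : ℕ :=
  Module.finrank (FibreField t) (LocalAlexander X →ₗ[Laurent n] FibreField t)

variable {X} {k : ℕ} {t : Torus n}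

theorem mem_localCharVar_iff : t ∈ localCharVar X k ↔ k ≤ localDepth X t :=
  mem_charVariety_iff t

theorem fibreCharacter_localAb_of (t : Torus n) (i : Fin n) :
    (fibreCharacter t).comp (localAb X) (PresentedGroup.of i) = (t i : ℂ) := by
  change character t (localAb X (PresentedGroup.of i)) = _
  rw [localAb, PresentedGroup.toGroup.of]
  change ((∏ j, t j ^ (Pi.single i (1 : ℤ) : Fin n → ℤ) j : ℂˣ) : ℂ) = _
  rw [Finset.prod_eq_single i (fun j _ hj => by rw [Pi.single_eq_of_ne hj, zpow_zero]) (by simp),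
    Pi.single_eq_same, zpow_one]

theorem fibreCharacter_localAb_of_eq_one {i : Fin n} :
    (fibreCharacter t).comp (localAb X) (PresentedGroup.of i) = 1 ↔ t i = 1 := by
  rw [fibreCharacter_localAb_of]
  exact Units.val_eq_one

theorem prod_fibreCharacter_localAb_of_eq_one :
    ∏ i ∈ X, (fibreCharacter t).comp (localAb X) (PresentedGroup.of i) = 1 ↔
      ∏ i ∈ X, t i = 1 := by
  rw [← Units.val_eq_one, Units.coe_prod]
  exact Eq.congr_left (Finset.prod_congr rfl fun i _ => fibreCharacter_localAb_of t i)

theorem localDepth_of_notMem (ht : t ∉ localTorus X) : localDepth X t = 0 := by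
  rw [localDepth, finrank_alexander_hom, equivariantHoms_local_eq_bot, finrank_bot]
  simp only [prod_fibreCharacter_localAb_of_eq_one, fibreCharacter_localAb_of_eq_one]
  exact ht

theorem localDepth_of_mem (ht : t ∈ localTorus X) (ht1 : t ≠ 1) :
    localDepth X t = X.card - 2 := by
  obtain ⟨i, hi⟩ := Function.ne_iff.1 ht1
  rw [localDepth, finrank_alexander_hom]
  exact finrank_equivariantHoms_local _ (prod_fibreCharacter_localAb_of_eq_one.2 ht.1)
    (fun j hj => fibreCharacter_localAb_of_eq_one.2 (ht.2 j hj))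
    (mt fibreCharacter_localAb_of_eq_one.1 hi)

theorem localDepth_one (hX : X.Nonempty) : localDepth X 1 = (X.card - 1).choose 2 := by
  rw [localDepth, finrank_alexander_hom]
  refine finrank_equivariantHoms_local_one hX fun g => ?_
  change character 1 (localAb X g) = 1
  simp [character]

theorem mem_localCharVar_iff_of_ne_one (hk : 1 ≤ k) (ht1 : t ≠ 1) :
    t ∈ localCharVar X k ↔ k + 2 ≤ X.card ∧ t ∈ localTorus X := by
  rw [mem_localCharVar_iff]
  by_cases ht : t ∈ localTorus X
  · rw [localDepth_of_mem ht ht1]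
    simp only [ht, and_true]
    omega
  · rw [localDepth_of_notMem ht]
    exact ⟨fun h => absurd (hk.trans h) (by simp), fun h => absurd h.2 ht⟩

end LocalVariety

/-! ### Coarse characteristic varieties -/

namespace LineArrangement

open scoped Classical in
theorem mem_L2 {n : ℕ} {A : LineArrangement n} {X : Finset (Fin n)} :
    X ∈ A.L2 ↔ 2 ≤ X.card ∧ ∃ v, A.vertexSet v = X := by
  rw [L2, Finset.mem_filter]
  exact and_iff_right (Finset.mem_univ X)

theorem form_eq_zero_of_mem_vertexSet {n : ℕ} {A : LineArrangement n} {v : ℂ × ℂ} {i : Fin n}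
    (hi : i ∈ A.vertexSet v) : A.a i * v.1 + A.b i * v.2 - A.c i = 0 := by
  classical exact (Finset.mem_filter.1 hi).2

variable {n : ℕ} (A : LineArrangement n)

theorem two_le_card_of_mem_L2 {X : Finset (Fin n)} (hX : X ∈ A.L2) : 2 ≤ X.card :=
  (mem_L2.1 hX).1

/-- Two lines meet in at most one point, so distinct flats share at most one line. -/
theorem eq_of_mem_L2 {X Y : Finset (Fin n)} (hX : X ∈ A.L2) (hY : Y ∈ A.L2) {i j : Fin n}
    (hij : i ≠ j) (hiX : i ∈ X) (hjX : j ∈ X) (hiY : i ∈ Y) (hjY : j ∈ Y) : X = Y := by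
  obtain ⟨v, rfl⟩ := (mem_L2.1 hX).2
  obtain ⟨w, rfl⟩ := (mem_L2.1 hY).2
  have h {u : ℂ × ℂ} {i : Fin n} (hi : i ∈ A.vertexSet u) :
      A.a i * u.1 + A.b i * u.2 - A.c i = 0 := form_eq_zero_of_mem_vertexSet hi
  have hd := A.transverse i j hij
  have h1 : v.1 = w.1 := by
    refine mul_left_cancel₀ hd ?_
    linear_combination A.b j * (h hiX - h hiY) - A.b i * (h hjX - h hjY)
  have h2 : v.2 = w.2 := by
    refine mul_left_cancel₀ hd ?_
    linear_combination A.a i * (h hjX - h hjY) - A.a j * (h hiX - h hiY)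
  rw [Prod.ext h1 h2]

/-- The local tori of distinct flats meet only in the identity. -/
theorem eq_of_mem_localTorus {X Y : Finset (Fin n)} (hX : X ∈ A.L2) (hY : Y ∈ A.L2)
    {t : Torus n} (ht1 : t ≠ 1) (htX : t ∈ localTorus X) (htY : t ∈ localTorus Y) : X = Y := by
  obtain ⟨i, hi⟩ := Function.ne_iff.1 ht1
  have hi' : t i ≠ 1 := hi
  have hmem {Z : Finset (Fin n)} (htZ : t ∈ localTorus Z) {j : Fin n} (hj : t j ≠ 1) : j ∈ Z := by
    by_contra h
    exact hj (htZ.2 j h)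
  -- As the coordinates in `X` have product `1`, one more of them is different from `1`.
  obtain ⟨j, hji, hj⟩ : ∃ j, j ≠ i ∧ t j ≠ 1 := by
    by_contra! h
    have h1 := htX.1
    rw [Finset.prod_eq_single i (fun j _ hj => h j hj) fun h2 => absurd (hmem htX hi') h2] at h1
    exact hi' h1
  exact A.eq_of_mem_L2 hX hY hji.symm (hmem htX hi') (hmem htX hj) (hmem htY hi') (hmem htY hj)

theorem mem_coarseCharVar_iff {k : ℕ} {t : Torus n} :
    t ∈ A.coarseCharVar k ↔ k ≤ ∑ X ∈ A.L2, localDepth X t := by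
  rw [coarseCharVar, mem_charVariety_iff t, finrank_directSum_hom,
    ← Finset.sum_coe_sort A.L2 fun X => localDepth X t]
  rfl

theorem mem_coarseCharVar_iff_of_ne_one {k : ℕ} (hk : 1 ≤ k) {t : Torus n} (ht1 : t ≠ 1) :
    t ∈ A.coarseCharVar k ↔ ∃ X ∈ A.L2, t ∈ localCharVar X k := by
  rw [mem_coarseCharVar_iff A]
  simp only [mem_localCharVar_iff]
  constructor
  · intro h
    obtain ⟨X, hX, hX0⟩ := Finset.exists_ne_zero_of_sum_ne_zero
      (show ∑ X ∈ A.L2, localDepth X t ≠ 0 by omega)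
    have htX : t ∈ localTorus X := by
      by_contra h
      exact hX0 (localDepth_of_notMem h)
    refine ⟨X, hX, ?_⟩
    rwa [Finset.sum_eq_single_of_mem X hX fun Y hY hYX => localDepth_of_notMem fun htY =>
      hYX (A.eq_of_mem_localTorus hY hX ht1 htY htX)] at h
  · rintro ⟨X, hX, h⟩
    exact h.trans <|
      Finset.single_le_sum (f := fun X => localDepth X t) (fun _ _ => Nat.zero_le _) hX

theorem coarseCharVar_diff_one {k : ℕ} (hk : 1 ≤ k) :
    A.coarseCharVar k \ {1} = (⋃ X ∈ A.L2, localCharVar X k) \ {1} := by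
  ext t
  simp only [Set.mem_sdiff, Set.mem_singleton_iff, Set.mem_iUnion, exists_prop]
  exact and_congr_left fun ht1 => A.mem_coarseCharVar_iff_of_ne_one hk ht1

theorem iUnion_localCharVar_diff_one {k : ℕ} (hk : 1 ≤ k) :
    (⋃ X ∈ A.L2, localCharVar X k) \ {1} =
      (⋃ X ∈ A.L2, ⋃ (_ : k + 2 ≤ X.card), localTorus X) \ {1} := by
  ext t
  simp only [Set.mem_sdiff, Set.mem_singleton_iff, Set.mem_iUnion, exists_prop]
  exact and_congr_left fun ht1 => exists_congr fun X => and_congr_right fun _ =>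
    mem_localCharVar_iff_of_ne_one hk ht1

theorem one_mem_coarseCharVar_iff {k : ℕ} :
    1 ∈ A.coarseCharVar k ↔ k ≤ ∑ X ∈ A.L2, (X.card - 1).choose 2 := by
  rw [mem_coarseCharVar_iff A, Finset.sum_congr rfl fun X hX => localDepth_one
    (Finset.card_pos.1 (zero_lt_two.trans_le (A.two_le_card_of_mem_L2 hX)))]

theorem one_mem_iUnion_localCharVar_iff {k : ℕ} :
    1 ∈ (⋃ X ∈ A.L2, localCharVar X k) ↔ ∃ X ∈ A.L2, k ≤ (X.card - 1).choose 2 := by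
  simp only [Set.mem_iUnion, exists_prop, mem_localCharVar_iff]
  refine exists_congr fun X => and_congr_right fun hX => ?_
  rw [localDepth_one (Finset.card_pos.1 (zero_lt_two.trans_le (A.two_le_card_of_mem_L2 hX)))]

theorem one_mem_iUnion_localTorus_iff {k : ℕ} :
    1 ∈ (⋃ X ∈ A.L2, ⋃ (_ : k + 2 ≤ X.card), localTorus X) ↔ ∃ X ∈ A.L2, k + 2 ≤ X.card := by
  simp [localTorus]

theorem charVar_eq_coarseCharVar {x : A.Complement} (h : A.IsDecomposable x) (k : ℕ) :
    A.charVar x k = A.coarseCharVar k := by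
  obtain ⟨e⟩ := h
  rw [charVar, coarseCharVar, charVariety, charVariety, fittingIdeal_congr e]

end LineArrangement

theorem le_choose_two_of_add_two_le {k m : ℕ} (h : k + 2 ≤ m) : k ≤ (m - 1).choose 2 := by
  obtain ⟨r, rfl⟩ := Nat.exists_eq_add_of_le h
  calc k ≤ k + r := Nat.le_add_right _ _
    _ = (k + r).choose 1 := (Nat.choose_one_right _).symm
    _ ≤ (k + r).choose 1 + (k + r).choose 2 := Nat.le_add_right _ _
    _ = (k + r + 1).choose 2 := (Nat.choose_succ_succ _ _).symm
    _ = (k + 2 + r - 1).choose 2 := by congr 1; omega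

theorem eq_of_diff_singleton_eq {α : Type*} {S T : Set α} {a : α} (h : S \ {a} = T \ {a})
    (hS : a ∈ S) (hT : a ∈ T) : S = T := by
  rw [← Set.insert_sdiff_self_of_mem hS, h, Set.insert_sdiff_self_of_mem hT]

end CharVar

end

open CharVar in
theorem mainTheorem4 {n : ℕ} (A : LineArrangement n) (k : ℕ) (hk : 1 ≤ k) :
    -- away from the identity, the three sets agree for every `k ≥ 1`
    (A.coarseCharVar k \ {1} = (⋃ X ∈ A.L2, localCharVar X k) \ {1} ∧
      (⋃ X ∈ A.L2, localCharVar X k) \ {1} =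
        (⋃ X ∈ A.L2, ⋃ (_ : k + 2 ≤ X.card), localTorus X) \ {1}) ∧
    -- which of the three sets contain the identity
    ((1 ∈ A.coarseCharVar k ↔ k ≤ ∑ X ∈ A.L2, (X.card - 1).choose 2) ∧
      (1 ∈ (⋃ X ∈ A.L2, localCharVar X k) ↔ ∃ X ∈ A.L2, k ≤ (X.card - 1).choose 2) ∧
      (1 ∈ (⋃ X ∈ A.L2, ⋃ (_ : k + 2 ≤ X.card), localTorus X) ↔
        ∃ X ∈ A.L2, k + 2 ≤ X.card)) ∧
    -- hence the three sets are equal as soon as some flat has at least `k + 2` lines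
    ((∃ X ∈ A.L2, k + 2 ≤ X.card) →
      (A.coarseCharVar k = (⋃ X ∈ A.L2, localCharVar X k)) ∧
      (⋃ X ∈ A.L2, localCharVar X k) =
        (⋃ X ∈ A.L2, ⋃ (_ : k + 2 ≤ X.card), localTorus X)) ∧
    -- the decomposable case
    (∀ x : A.Complement, A.IsDecomposable x →
      A.charVar x k = A.coarseCharVar k ∧
      A.charVar x k \ {1} =
        (⋃ X ∈ A.L2, ⋃ (_ : k + 2 ≤ X.card), localTorus X) \ {1} ∧
      ((∃ X ∈ A.L2, k + 2 ≤ X.card) →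
        A.charVar x k = (⋃ X ∈ A.L2, ⋃ (_ : k + 2 ≤ X.card), localTorus X))) := by
  have h1 := A.coarseCharVar_diff_one hk
  have h2 := A.iUnion_localCharVar_diff_one hk
  have h3 := A.one_mem_coarseCharVar_iff (k := k)
  have h4 := A.one_mem_iUnion_localCharVar_iff (k := k)
  have h5 := A.one_mem_iUnion_localTorus_iff (k := k)
  have h6 (h : ∃ X ∈ A.L2, k + 2 ≤ X.card) : A.coarseCharVar k = (⋃ X ∈ A.L2, localCharVar X k) ∧
      (⋃ X ∈ A.L2, localCharVar X k) =
        (⋃ X ∈ A.L2, ⋃ (_ : k + 2 ≤ X.card), localTorus X) := by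
    obtain ⟨X, hX, hkX⟩ := h
    have h7 := le_choose_two_of_add_two_le hkX
    have h8 : 1 ∈ ⋃ X ∈ A.L2, localCharVar X k := h4.2 ⟨X, hX, h7⟩
    have h9 : 1 ∈ A.coarseCharVar k := h3.2 <| h7.trans <|
      Finset.single_le_sum (f := fun X : Finset (Fin n) => (X.card - 1).choose 2)
        (fun _ _ => Nat.zero_le _) hX
    exact ⟨eq_of_diff_singleton_eq h1 h9 h8, eq_of_diff_singleton_eq h2 h8 (h5.2 ⟨X, hX, hkX⟩)⟩
  refine ⟨⟨h1, h2⟩, ⟨h3, h4, h5⟩, h6, fun x hx => ?_⟩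
  rw [A.charVar_eq_coarseCharVar hx]
  exact ⟨rfl, h1.trans h2, fun h => (h6 h).1.trans (h6 h).2⟩
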